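/- Let $n\ge 0$. A Ferrers diagram is a top and left justified arrangement of square cells, with possibly empty rows and columns; its length is its number of rows plus its number of columns. If it has $k$ columns, its shifted diagram is obtained by adding above it $k$ left justified rows of sizes $1,2,\dots,k$ (from top to bottom); the rightmost cell of an added row is called diagonal, and the length of the shifted diagram is that of the original one. A type $B$ permutation tableau of length $n$ is a filling with $0$'s and $1$'s of a shifted Ferrers diagram of length $n$ such that (1) each column contains a $1$; (2) no $0$ has both a $1$ above it in its column and a $1$ to the left of it in its row; (3) a $0$ in a diagonal cell has no $1$ to the left of it in its row. Let $\mathrm{row}(T)$ be the number of rows of $T$ other than the added ones, $\mathrm{diag}(T)$ the number of $1$'s in diagonal cells, and $\mathrm{so}(T)$ the number of superfluous $1$'s, that is, of $1$'s having a $1$ above them in the same column. Put $$B_n(y,t,q)=\sum_{T} y^{2\,\mathrm{row}(T)+\mathrm{diag}(T)}\,t^{\mathrm{diag}(T)}\,q^{\mathrm{so}(T)},$$ the sum running over all type $B$ permutation tableaux $T$ of length $n$. A signed permutation $\pi=\pi_1\cdots\pi_n$ of $[n]=\{1,\dots,n\}$ is a permutation of $[n]$ in which each entry may be negated; $B_n$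 also denotes the set of these. Let $\mathrm{neg}(\pi)=\#\{i\in[n]:\pi_i<0\}$, $\mathrm{fwex}(\pi)=2\,\#\{i\in[n]:\pi_i\ge i\}+\mathrm{neg}(\pi)$, and let $\mathrm{cro}(\pi)$ be the number of pairs $(i,j)\in[n]^2$ such that $i<j\le\pi_i<\pi_j$, or $-i<j\le-\pi_i<\pi_j$, or $i>j>\pi_i>\pi_j$. Then, as polynomials in $y,t,q$, $$B_n(y,t,q)=\sum_{\pi\in B_n} y^{\mathrm{fwex}(\pi)}\,t^{\mathrm{neg}(\pi)}\,q^{\mathrm{cro}(\pi)}.$$ Equivalently, for every $k\ge 0$, the coefficient of $y^k$ in $B_n(y,t,q)$ is $$\sum_{\pi\in B_n,\ \mathrm{fwex}(\pi)=k} t^{\mathrm{neg}(\pi)}\,q^{\mathrm{cro}(\pi)}.$$ -/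

import Mathlib

/-- A Ferrers diagram: a top and left justified arrangement of cells, with possibly empty rows and
columns.  It is a Young diagram `shape` (cells `(i, j)`, row `i` counted from the top and column `j`
counted from the left, both starting with `0`) together with the numbers of rows and columns. -/
structure FerrersDiagram where
  rows : ℕ
  cols : ℕ
  shape : YoungDiagram
  row_lt : ∀ i j : ℕ, (i, j) ∈ shape → i < rows
  col_lt : ∀ i j : ℕ, (i, j) ∈ shape → j < cols

namespace FerrersDiagram

/-- The length: number of rows plus number of columns. -/
def length (F : FerrersDiagram) : ℕ := F.rows + F.cols

/-- `(i, j)` is a cell of the shifted Ferrers diagram: the rows `0, …, F.cols - 1` are the added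
rows, row `i` of them having size `i + 1`, and row `F.cols + r` is the row `r` of `F`. -/
def ShiftedCell (F : FerrersDiagram) (i j : ℕ) : Prop :=
  (i < F.cols ∧ j ≤ i) ∨ ∃ r : ℕ, i = F.cols + r ∧ (r, j) ∈ F.shape

/-- `(i, j)` is a diagonal cell: the rightmost cell of an added row. -/
def DiagonalCell (F : FerrersDiagram) (i j : ℕ) : Prop :=
  i < F.cols ∧ j = i

end FerrersDiagram

/-- A type `B` permutation tableau of length `n`: a `0,1`-filling of a shifted Ferrers diagram of
length `n`, given by the set `ones` of the cells that contain a `1`. -/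
structure TypeBTableau (n : ℕ) where
  diagram : FerrersDiagram
  length_eq : diagram.length = n
  ones : Finset (ℕ × ℕ)
  ones_cell : ∀ i j : ℕ, (i, j) ∈ ones → diagram.ShiftedCell i j
  /-- Each column has at least one `1`. -/
  column_one : ∀ j : ℕ, j < diagram.cols → ∃ i : ℕ, (i, j) ∈ ones
  /-- No `0` has a `1` above it in its column and a `1` to the left of it in its row. -/
  zero_cond : ∀ i j : ℕ, diagram.ShiftedCell i j → (i, j) ∉ ones →
    ¬ ((∃ i' : ℕ, i' < i ∧ (i', j) ∈ ones) ∧ (∃ j' : ℕ, j' < j ∧ (i, j') ∈ ones))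
  /-- A `0` in a diagonal cell has no `1` to the left of it in its row. -/
  diag_cond : ∀ i j : ℕ, diagram.DiagonalCell i j → (i, j) ∉ ones →
    ¬ ∃ j' : ℕ, j' < j ∧ (i, j') ∈ ones

namespace TypeBTableau

theorem injective_data (n : ℕ) : Function.Injective
    (fun T : TypeBTableau n =>
      (T.diagram.rows, T.diagram.cols, T.diagram.shape.cells, T.ones)) := by
  rintro ⟨⟨r, c, ⟨s, hs⟩, h1, h2⟩, h3, o, h4, h5, h6, h7⟩
    ⟨⟨r', c', ⟨s', hs'⟩, h1', h2'⟩, h3', o', h4', h5', h6', h7'⟩ h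
  simp only [Prod.mk.injEq] at h
  obtain ⟨rfl, rfl, rfl, rfl⟩ := h
  rfl

instance finite (n : ℕ) : Finite (TypeBTableau n) := by
  let S : Finset (ℕ × ℕ × Finset (ℕ × ℕ) × Finset (ℕ × ℕ)) :=
    Finset.range (n + 1) ×ˢ Finset.range (n + 1) ×ˢ
      (Finset.range n ×ˢ Finset.range n).powerset ×ˢ (Finset.range n ×ˢ Finset.range n).powerset
  refine Finite.of_injective (β := S)
    (fun T => ⟨(T.diagram.rows, T.diagram.cols, T.diagram.shape.cells, T.ones), ?_⟩) ?_
  · have hl : T.diagram.rows + T.diagram.cols = n := T.length_eq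
    have hs : ∀ i j : ℕ, (i, j) ∈ T.diagram.shape → i < T.diagram.rows ∧ j < T.diagram.cols :=
      fun i j h => ⟨T.diagram.row_lt i j h, T.diagram.col_lt i j h⟩
    simp only [S, Finset.mem_product, Finset.mem_powerset, Finset.mem_range]
    refine ⟨by omega, by omega, ?_, ?_⟩
    · rintro ⟨i, j⟩ h
      have := hs i j h
      simp only [Finset.mem_product, Finset.mem_range]
      omega
    · rintro ⟨i, j⟩ h
      simp only [Finset.mem_product, Finset.mem_range]
      rcases T.ones_cell i j h with h | ⟨r, h, h'⟩
      · omega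
      · have := hs r j h'
        omega
  · intro T T' h
    exact injective_data n (congrArg Subtype.val h)

noncomputable instance fintype (n : ℕ) : Fintype (TypeBTableau n) := Fintype.ofFinite _

variable {n : ℕ}

/-- The number of rows except the added rows. -/
def row (T : TypeBTableau n) : ℕ := T.diagram.rows

open Classical in
/-- The number of ones in the diagonal cells. -/
noncomputable def diag (T : TypeBTableau n) : ℕ :=
  (T.ones.filter fun c => T.diagram.DiagonalCell c.1 c.2).card

open Classical in
/-- The number of superfluous ones, i.e. of ones with a `1` above them in the same column. -/
noncomputable def so (T : TypeBTableau n) : ℕ :=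
  (T.ones.filter fun c => ∃ i' : ℕ, i' < c.1 ∧ (i', c.2) ∈ T.ones).card

end TypeBTableau

/-- The polynomial ring `ℤ[t, q][y]`. -/
abbrev PolyYTQ : Type := Polynomial (MvPolynomial (Fin 2) ℤ)

namespace PolyYTQ

/-- The variable `t` of `ℤ[t, q]`. -/
noncomputable def t : MvPolynomial (Fin 2) ℤ := MvPolynomial.X 0

/-- The variable `q` of `ℤ[t, q]`. -/
noncomputable def q : MvPolynomial (Fin 2) ℤ := MvPolynomial.X 1

/-- The variable `y` of `ℤ[t, q][y]`. -/
noncomputable def y : PolyYTQ := Polynomial.X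

end PolyYTQ

/-- The generating function `B_n(y, t, q)` of the type `B` permutation tableaux of length `n`. -/
noncomputable def tableauPoly (n : ℕ) : PolyYTQ :=
  ∑ T : TypeBTableau n,
    PolyYTQ.y ^ (2 * T.row + T.diag) * Polynomial.C PolyYTQ.t ^ T.diag *
      Polynomial.C PolyYTQ.q ^ T.so

/-- A signed permutation of `[n]`: a permutation each of whose values may be negated.  The element
`i : Fin n` stands for the integer `i + 1` of `[n]`. -/
abbrev SignedPerm (n : ℕ) : Type := Equiv.Perm (Fin n) × (Fin n → ℤˣ)

namespace SignedPerm

variable {n : ℕ}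

/-- The element of `[n] = {1, …, n}`, as an integer, that `i : Fin n` stands for. -/
def pos (i : Fin n) : ℤ := (i : ℤ) + 1

/-- The value `π_i`, a nonzero integer between `-n` and `n`. -/
def val (π : SignedPerm n) (i : Fin n) : ℤ := (π.2 i : ℤ) * pos (π.1 i)

/-- The number of weak excedances. -/
def wex (π : SignedPerm n) : ℕ :=
  (Finset.univ.filter fun i : Fin n => pos i ≤ val π i).card

/-- The number of negative values. -/
def neg (π : SignedPerm n) : ℕ :=
  (Finset.univ.filter fun i : Fin n => val π i < 0).card

/-- The number of flag weak excedances. -/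
def fwex (π : SignedPerm n) : ℕ := 2 * wex π + neg π

/-- The pair `(i, j)` is a crossing of `π`. -/
def IsCrossing (π : SignedPerm n) (i j : Fin n) : Prop :=
  (pos i < pos j ∧ pos j ≤ val π i ∧ val π i < val π j) ∨
  (-pos i < pos j ∧ pos j ≤ -val π i ∧ -val π i < val π j) ∨
  (pos i > pos j ∧ pos j > val π i ∧ val π i > val π j)

instance (π : SignedPerm n) (i j : Fin n) : Decidable (IsCrossing π i j) := by
  unfold IsCrossing
  infer_instance

/-- The number of crossings. -/
def cro (π : SignedPerm n) : ℕ :=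
  (Finset.univ.filter fun p : Fin n × Fin n => IsCrossing π p.1 p.2).card

end SignedPerm

/-! Both sides are n-fold iterates of linear operators, and a kernel intertwines the two operators.
Put p = y² and s = yt.

A tableau grows by an empty bottom row or by a new left column meeting every row. The only memory
needed is the number m of unrestricted rows, those that may still receive a 1 on the left. With
(Sφ)(m) = φ(m+1) and T = `columnOp`, the tableau side is (pS + T)ⁿ1 at m = 0 (`tableauSum_eq`).

For signed permutations of size k + N satisfying `Bounded k k`, let G_k(N) be the generating
function. Removing the value k+1 when it sits beyond position k+1, and the entry at position k+1
when it is a weak excedance, gives G_{k+1} = (pE + D)G_k with E = `excedanceOp` and D = `dropOp`.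
The start G_0 = w = `motzkinEnd` counts the permutations with all entries negative; for k = n, N = 0
the bound is vacuous. So this side is (pE + D)ⁿw at N = 0 (`sum_weight`).

The two pairs satisfy the same relation, ST = T + qTS + S and DE = D + qED + E, and the same
boundary condition, (Tφ)(0) = s(Sφ)(0) and Dw = sEw. Hence on the kernel K_m(N) = (Eᵐw)(N), S and T
acting in m agree with E and D acting in N (`columnOp_motzkinKernel`). Operators in m commute with
operators in N, so the agreement survives iteration, and K_0 = w together with K_m(0) = 1 gives the
theorem. -/

/-! ### Operator algebra: intertwining the two recurrences. -/

section QAlgebra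

variable {R : Type*} [CommRing R]

/-- The `q`-integer `1 + q + ⋯ + q ^ (n - 1)`. -/
def qInt (q : R) (n : ℕ) : R := ∑ i ∈ Finset.range n, q ^ i

@[simp] theorem qInt_zero (q : R) : qInt q 0 = 0 := by simp [qInt]

theorem qInt_succ (q : R) (n : ℕ) : qInt q (n + 1) = q * qInt q n + 1 := by
  simp [qInt, Finset.sum_range_succ', Finset.mul_sum, pow_succ']

/-- The effect of adding a column on functions of the number of unrestricted rows. -/
def columnOp (s q : R) (φ : ℕ → R) : ℕ → R
  | 0 => s * φ 1
  | m + 1 => columnOp s q φ m + q * columnOp s q (fun k => φ (k + 1)) m + φ (m + 1)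

theorem columnOp_add_mul (s q a b : R) (φ ψ : ℕ → R) (m : ℕ) :
    columnOp s q (fun k => a * φ k + b * ψ k) m =
      a * columnOp s q φ m + b * columnOp s q ψ m := by
  induction m generalizing φ ψ with
  | zero => simp only [columnOp]; ring
  | succ m ih =>
    simp only [columnOp]
    rw [ih, ih (fun k => φ (k + 1)) (fun k => ψ (k + 1))]
    ring

/-- The effect of adding a row or a column on functions of the number of unrestricted rows. -/
def tableauStep (p s q : R) (φ : ℕ → R) (m : ℕ) : R :=
  p * φ (m + 1) + columnOp s q φ m

/-- One step of the Motzkin path at a position that is a weak excedance. -/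
def excedanceOp (q : R) (G : ℕ → R) (N : ℕ) : R :=
  qInt q (N + 1) * G N + qInt q N ^ 2 * G (N - 1)

/-- One step of the Motzkin path at a position that is not a weak excedance. -/
def dropOp (q : R) (G : ℕ → R) (N : ℕ) : R :=
  1 * G (N + 1) + qInt q N * G N

/-- One step of the Motzkin path. -/
def motzkinStep (p q : R) (G : ℕ → R) (N : ℕ) : R :=
  p * excedanceOp q G N + 1 * dropOp q G N

/-- The generating function of the negative signed permutations of `[N]`. -/
def motzkinEnd (s q : R) (N : ℕ) : R := ∏ i ∈ Finset.range N, (s * qInt q (i + 1))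

theorem motzkinEnd_succ (s q : R) (N : ℕ) :
    motzkinEnd s q (N + 1) = motzkinEnd s q N * (s * qInt q (N + 1)) :=
  Finset.prod_range_succ _ _

/-- The counterpart of the recursive clause of `columnOp`, with the shift replaced by `excedanceOp`
and `columnOp` by `dropOp`. -/
theorem dropOp_excedanceOp (q : R) (G : ℕ → R) (N : ℕ) :
    dropOp q (excedanceOp q G) N =
      dropOp q G N + q * excedanceOp q (dropOp q G) N + excedanceOp q G N := by
  -- The truncated `N - 1` at `N = 0` is harmless because its coefficient `qInt q 0` vanishes.
  rcases N with _ | N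
  · simp only [dropOp, excedanceOp, qInt_succ, qInt_zero, add_tsub_cancel_right]
    ring
  · simp only [dropOp, excedanceOp, qInt_succ, add_tsub_cancel_right]
    rcases N with _ | N
    · simp only [qInt_zero]
      ring
    · simp only [qInt_succ]
      ring

/-- The counterpart of the clause of `columnOp` at `0`. -/
theorem dropOp_motzkinEnd (s q : R) (N : ℕ) :
    dropOp q (motzkinEnd s q) N = s * excedanceOp q (motzkinEnd s q) N := by
  rcases N with _ | N
  · simp [dropOp, excedanceOp, motzkinEnd_succ]
    ring
  · simp only [dropOp, excedanceOp, motzkinEnd_succ, add_tsub_cancel_right]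
    ring

/-- The kernel that intertwines the two families of operators. -/
def motzkinKernel (s q : R) (m : ℕ) : ℕ → R := (excedanceOp q)^[m] (motzkinEnd s q)

theorem motzkinKernel_succ (s q : R) (m : ℕ) :
    motzkinKernel s q (m + 1) = excedanceOp q (motzkinKernel s q m) :=
  Function.iterate_succ_apply' _ _ _

/-- Since [1] = 1 and [0] = 0, `excedanceOp` does not change the value at `0`. -/
theorem motzkinKernel_zero_right (s q : R) (m : ℕ) : motzkinKernel s q m 0 = 1 := by
  induction m with
  | zero => simp [motzkinKernel, motzkinEnd]
  | succ m ih => simp [motzkinKernel_succ, excedanceOp, ih, qInt_succ]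

theorem columnOp_motzkinKernel (s q : R) (m N : ℕ) :
    columnOp s q (fun k => motzkinKernel s q k N) m = dropOp q (motzkinKernel s q m) N := by
  induction m generalizing N with
  | zero =>
    rw [columnOp, motzkinKernel_succ]
    exact (dropOp_motzkinEnd s q N).symm
  | succ m ih =>
    rw [columnOp, motzkinKernel_succ, dropOp_excedanceOp, ih N]
    simp only [motzkinKernel_succ]
    simp only [excedanceOp]
    -- `excedanceOp` combines finitely many values in `N` with coefficients free of `m`, so the
    -- linear `columnOp` passes through it.
    rw [columnOp_add_mul, ih, ih]

theorem tableauStep_add_mul (p s q a b : R) (φ ψ : ℕ → R) (m : ℕ) :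
    tableauStep p s q (fun k => a * φ k + b * ψ k) m =
      a * tableauStep p s q φ m + b * tableauStep p s q ψ m := by
  simp only [tableauStep, columnOp_add_mul]
  ring

/-- `tableauStep` acts in `m` and `motzkinStep` in `N`, so by linearity they commute; on the bare
kernel they agree. -/
theorem tableauStep_motzkinStep_iterate (p s q : R) (n m N : ℕ) :
    tableauStep p s q (fun k => (motzkinStep p q)^[n] (motzkinKernel s q k) N) m =
      (motzkinStep p q)^[n + 1] (motzkinKernel s q m) N := by
  induction n generalizing N with
  | zero =>
    simp only [Function.iterate_zero, id, zero_add, Function.iterate_one, tableauStep,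
      columnOp_motzkinKernel, motzkinStep, motzkinKernel_succ, one_mul]
  | succ n ih =>
    rw [Function.iterate_succ_apply']
    simp only [Function.iterate_succ_apply' _ n] at ih ⊢
    simp only [motzkinStep, excedanceOp, dropOp] at ih ⊢
    rw [tableauStep_add_mul, tableauStep_add_mul, tableauStep_add_mul]
    simp only [ih]

theorem tableauStep_iterate_motzkinKernel (p s q : R) (n m N : ℕ) :
    (tableauStep p s q)^[n] (fun k => motzkinKernel s q k N) m =
      (motzkinStep p q)^[n] (motzkinKernel s q m) N := by
  induction n generalizing m with
  | zero => rfl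
  | succ n ih =>
    rw [Function.iterate_succ_apply', ← tableauStep_motzkinStep_iterate]
    congr 1
    exact funext ih

theorem tableauStep_iterate_one (p s q : R) (n : ℕ) :
    (tableauStep p s q)^[n] (fun _ => 1) 0 = (motzkinStep p q)^[n] (motzkinEnd s q) 0 := by
  have h := tableauStep_iterate_motzkinKernel p s q n 0 0
  simp only [motzkinKernel_zero_right] at h
  exact h

end QAlgebra

/-! ### Signed permutations: inserting one entry. -/

namespace SignedPerm

variable {n m : ℕ}

/-- Insert the position `i` with value `v`, carrying the sign `e`, into a signed permutation. -/
def insertEntry (i v : Fin (m + 1)) (e : ℤˣ) (σ : SignedPerm m) : SignedPerm (m + 1) :=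
  ((finSuccEquiv' i).trans ((Equiv.optionCongr σ.1).trans (finSuccEquiv' v).symm),
    i.insertNth (α := fun _ => ℤˣ) e σ.2)

@[simp] theorem insertEntry_perm_same (i v : Fin (m + 1)) (e : ℤˣ) (σ : SignedPerm m) :
    (insertEntry i v e σ).1 i = v := by
  simp [insertEntry]

@[simp] theorem insertEntry_perm_succAbove (i v : Fin (m + 1)) (e : ℤˣ) (σ : SignedPerm m)
    (j : Fin m) : (insertEntry i v e σ).1 (i.succAbove j) = v.succAbove (σ.1 j) := by
  simp [insertEntry]

@[simp] theorem insertEntry_sign_same (i v : Fin (m + 1)) (e : ℤˣ) (σ : SignedPerm m) :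
    (insertEntry i v e σ).2 i = e := by
  simp [insertEntry]

@[simp] theorem insertEntry_sign_succAbove (i v : Fin (m + 1)) (e : ℤˣ) (σ : SignedPerm m)
    (j : Fin m) : (insertEntry i v e σ).2 (i.succAbove j) = σ.2 j := by
  simp [insertEntry]

theorem insertEntry_injective {i v v' : Fin (m + 1)} {e e' : ℤˣ} {σ σ' : SignedPerm m}
    (h : insertEntry i v e σ = insertEntry i v' e' σ') : v = v' ∧ e = e' ∧ σ = σ' := by
  have hv : v = v' := by
    rw [← insertEntry_perm_same i v e σ, h, insertEntry_perm_same]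
  subst hv
  refine ⟨rfl, ?_, Prod.ext (Equiv.ext fun j => ?_) (funext fun j => ?_)⟩
  · rw [← insertEntry_sign_same i v e σ, h, insertEntry_sign_same]
  · apply Fin.succAbove_right_injective (p := v)
    rw [← insertEntry_perm_succAbove i v e σ, h, insertEntry_perm_succAbove]
  · rw [← insertEntry_sign_succAbove i v e σ, h, insertEntry_sign_succAbove]

theorem card_eq (n : ℕ) : Fintype.card (SignedPerm n) = n.factorial * 2 ^ n := by
  simp [SignedPerm, Fintype.card_perm]

theorem insertEntry_bijective_of_position (i : Fin (m + 1)) :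
    Function.Bijective fun x : Fin (m + 1) × ℤˣ × SignedPerm m =>
      insertEntry i x.1 x.2.1 x.2.2 := by
  -- Injectivity suffices: both sides have (m+1)!·2^(m+1) elements.
  rw [Fintype.bijective_iff_injective_and_card]
  constructor
  · rintro ⟨v, e, σ⟩ ⟨v', e', σ'⟩ h
    obtain ⟨rfl, rfl, rfl⟩ := insertEntry_injective h
    rfl
  · rw [Fintype.card_prod, Fintype.card_prod, card_eq, card_eq, Fintype.card_fin,
      Fintype.card_units_int, Nat.factorial_succ, pow_succ]
    ring

theorem insertEntry_bijective_of_value (v : Fin (m + 1)) :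
    Function.Bijective fun x : Fin (m + 1) × ℤˣ × SignedPerm m =>
      insertEntry x.1 v x.2.1 x.2.2 := by
  rw [Fintype.bijective_iff_injective_and_card]
  constructor
  · rintro ⟨i, e, σ⟩ ⟨i', e', σ'⟩ h
    have hi : i = i' := by
      apply (insertEntry i v e σ).1.injective
      have h' : insertEntry i v e σ = insertEntry i' v e' σ' := h
      rw [insertEntry_perm_same, h', insertEntry_perm_same]
    subst hi
    obtain ⟨-, rfl, rfl⟩ := insertEntry_injective h
    rfl
  · rw [Fintype.card_prod, Fintype.card_prod, card_eq, card_eq, Fintype.card_fin,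
      Fintype.card_units_int, Nat.factorial_succ, pow_succ]
    ring

theorem coe_succAbove (i : Fin (m + 1)) (j : Fin m) :
    ((j : ℕ) < i ∧ (i.succAbove j : ℕ) = j) ∨ ((i : ℕ) ≤ j ∧ (i.succAbove j : ℕ) = j + 1) := by
  rcases lt_or_ge j.castSucc i with h | h
  · exact Or.inl ⟨h, by rw [Fin.succAbove_of_castSucc_lt _ _ h]; rfl⟩
  · exact Or.inr ⟨h, by rw [Fin.succAbove_of_le_castSucc _ _ h]; rfl⟩

/-- The value at an old position after an insertion. -/
theorem val_insertEntry_succAbove (i v : Fin (m + 1)) (e : ℤˣ) (σ : SignedPerm m) (j : Fin m) :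
    (val σ j = (σ.1 j : ℕ) + 1 ∧
      val (insertEntry i v e σ) (i.succAbove j) = (v.succAbove (σ.1 j) : ℕ) + 1) ∨
    (val σ j = -((σ.1 j : ℕ) + 1) ∧
      val (insertEntry i v e σ) (i.succAbove j) = -((v.succAbove (σ.1 j) : ℕ) + 1)) := by
  rcases Int.units_eq_one_or (σ.2 j) with h | h <;> simp [val, pos, h]

theorem val_insertEntry_same (i v : Fin (m + 1)) (e : ℤˣ) (σ : SignedPerm m) :
    val (insertEntry i v e σ) i = e * ((v : ℕ) + 1) := by
  simp [val, pos]

theorem not_isCrossing_self (π : SignedPerm n) (i : Fin n) : ¬ IsCrossing π i i := by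
  unfold IsCrossing
  have : pos i = (i : ℕ) + 1 := rfl
  omega

theorem wex_insertEntry (i v : Fin (m + 1)) (e : ℤˣ) (σ : SignedPerm m)
    (h : ∀ j, pos (i.succAbove j) ≤ val (insertEntry i v e σ) (i.succAbove j) ↔
      pos j ≤ val σ j) :
    wex (insertEntry i v e σ) =
      (if pos i ≤ val (insertEntry i v e σ) i then 1 else 0) + wex σ := by
  simp only [wex, Finset.card_filter]
  rw [Fin.sum_univ_succAbove _ i]
  simp only [h]

theorem neg_insertEntry (i v : Fin (m + 1)) (e : ℤˣ) (σ : SignedPerm m) :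
    neg (insertEntry i v e σ) = (if e = -1 then 1 else 0) + neg σ := by
  simp only [neg, Finset.card_filter]
  rw [Fin.sum_univ_succAbove _ i]
  congr 1
  · rw [val_insertEntry_same]
    rcases Int.units_eq_one_or e with rfl | rfl
    · simp
      omega
    · simp
      omega
  · refine Finset.sum_congr rfl fun j _ => if_congr ?_ rfl rfl
    have := val_insertEntry_succAbove i v e σ j
    omega

theorem cro_insertEntry (i v : Fin (m + 1)) (e : ℤˣ) (σ : SignedPerm m) (P Q : Fin m → Prop)
    [DecidablePred P] [DecidablePred Q]
    (hP : ∀ j, IsCrossing (insertEntry i v e σ) i (i.succAbove j) ↔ P j)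
    (hQ : ∀ j, IsCrossing (insertEntry i v e σ) (i.succAbove j) i ↔ Q j)
    (h : ∀ j l, IsCrossing (insertEntry i v e σ) (i.succAbove j) (i.succAbove l) ↔
      IsCrossing σ j l) :
    cro (insertEntry i v e σ) = (Finset.univ.filter P).card + (Finset.univ.filter Q).card +
      cro σ := by
  simp only [cro, Finset.card_filter]
  rw [Fintype.sum_prod_type, Fintype.sum_prod_type, Fin.sum_univ_succAbove _ i]
  simp only [Fin.sum_univ_succAbove _ i, not_isCrossing_self, hP, hQ, h, if_false,
    Finset.sum_add_distrib]
  ring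

/-- Insertion preserves the order among positions and among signed values. Only comparisons of a
position with a value can change, and each matters only when another inequality of its pattern
holds. -/
theorem isCrossing_insertEntry (i v : Fin (m + 1)) (e : ℤˣ) (σ : SignedPerm m) (j l : Fin m)
    (h₁ : val σ j < val σ l →
      (pos (i.succAbove l) ≤ val (insertEntry i v e σ) (i.succAbove j) ↔ pos l ≤ val σ j))
    (h₂ : -val σ j < val σ l →
      (pos (i.succAbove l) ≤ -val (insertEntry i v e σ) (i.succAbove j) ↔ pos l ≤ -val σ j))
    (h₃ : pos l < pos j →
      (val (insertEntry i v e σ) (i.succAbove j) < pos (i.succAbove l) ↔ val σ j < pos l)) :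
    IsCrossing (insertEntry i v e σ) (i.succAbove j) (i.succAbove l) ↔ IsCrossing σ j l := by
  have hpos (j l : Fin m) : pos (i.succAbove j) < pos (i.succAbove l) ↔ pos j < pos l := by
    have := @Fin.succAbove_lt_succAbove_iff m i j l
    rw [Fin.lt_def, Fin.lt_def] at this
    simp only [pos]
    omega
  have hpos' : -pos (i.succAbove j) < pos (i.succAbove l) ↔ -pos j < pos l := by
    simp only [pos]
    omega
  have hval (j l : Fin m) : val (insertEntry i v e σ) (i.succAbove j) <
      val (insertEntry i v e σ) (i.succAbove l) ↔ val σ j < val σ l := by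
    have := val_insertEntry_succAbove i v e σ j
    have := coe_succAbove v (σ.1 j)
    have := val_insertEntry_succAbove i v e σ l
    have := coe_succAbove v (σ.1 l)
    omega
  have hval' : -val (insertEntry i v e σ) (i.succAbove j) <
      val (insertEntry i v e σ) (i.succAbove l) ↔ -val σ j < val σ l := by
    have := val_insertEntry_succAbove i v e σ j
    have := coe_succAbove v (σ.1 j)
    have := val_insertEntry_succAbove i v e σ l
    have := coe_succAbove v (σ.1 l)
    omega
  simp only [IsCrossing, gt_iff_lt, hpos, hpos', hval, hval']
  exact or_congr (and_congr_right fun _ => and_congr_left h₁)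
    (or_congr (and_congr_right fun _ => and_congr_left h₂)
      (and_congr_right fun h => and_congr_left fun _ => h₃ h))

/-- Every position after the first `a` ones has a value that is at most `b`. -/
def Bounded (a b : ℕ) (π : SignedPerm n) : Prop :=
  ∀ i : Fin n, a ≤ (i : ℕ) → val π i ≤ b

instance (a b : ℕ) (π : SignedPerm n) : Decidable (Bounded a b π) := by
  unfold Bounded
  infer_instance

/-! ### Weights of bounded signed permutations and the three kinds of insertion. -/

section Weight

variable {R : Type*} [CommRing R]

/-- The weight of a signed permutation. -/
def weight (p s q : R) (π : SignedPerm n) : R := p ^ wex π * s ^ neg π * q ^ cro π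

/-- The generating function of the bounded signed permutations. -/
def boundedSum (p s q : R) (a b n : ℕ) : R :=
  ∑ π : SignedPerm n, if Bounded a b π then weight p s q π else 0

end Weight

theorem card_filter_fin (n a b : ℕ) (hb : b ≤ n) :
    (Finset.univ.filter fun j : Fin n => a ≤ (j : ℕ) ∧ (j : ℕ) < b).card = b - a := by
  rw [← Nat.card_Ico, ← Finset.card_map Fin.valEmbedding]
  congr 1
  ext x
  simp only [Finset.mem_map, Finset.mem_filter, Finset.mem_univ, true_and, Finset.mem_Ico,
    Fin.valEmbedding_apply]
  constructor
  · rintro ⟨j, h, rfl⟩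
    exact h
  · rintro h
    exact ⟨⟨x, by omega⟩, h, rfl⟩

theorem card_filter_perm (σ : Equiv.Perm (Fin n)) (a b : ℕ) (hb : b ≤ n) :
    (Finset.univ.filter fun j : Fin n => a ≤ (σ j : ℕ) ∧ (σ j : ℕ) < b).card = b - a := by
  rw [← card_filter_fin n a b hb, ← Finset.card_map σ.toEmbedding]
  congr 1
  ext x
  simp only [Finset.mem_map, Finset.mem_filter, Finset.mem_univ, true_and,
    Equiv.coe_toEmbedding]
  constructor
  · rintro ⟨j, h, rfl⟩
    exact h
  · rintro h
    exact ⟨σ.symm x, by simpa using h, by simp⟩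

section DropValue

/-! Inserting the value `k + 1` at a position beyond `k + 1`. -/

variable {k : ℕ} (i v : Fin (m + 1)) (σ : SignedPerm m)

/-- The two bounds differ only in allowing the value `k + 1` beyond position `k + 1`, and the
inserted entry is the only one of absolute value `k + 1`. -/
theorem bounded_insertEntry_drop (e : ℤˣ) (hv : (v : ℕ) = k) :
    (Bounded (k + 1) (k + 1) (insertEntry i v e σ) ∧ ¬ Bounded (k + 1) k (insertEntry i v e σ)) ↔
      e = 1 ∧ k < (i : ℕ) ∧ Bounded (k + 1) k σ := by
  constructor
  · rintro ⟨h, h'⟩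
    simp only [Bounded, not_forall] at h'
    obtain ⟨l, hl, hl'⟩ := h'
    have h1 := h l hl
    have hli : l = i := by
      by_contra hne
      obtain ⟨j, rfl⟩ := Fin.exists_succAbove_eq hne
      have := val_insertEntry_succAbove i v e σ j
      have := coe_succAbove v (σ.1 j)
      push_cast at *
      omega
    subst hli
    rw [val_insertEntry_same] at hl' h1
    refine ⟨?_, by omega, fun j hj => ?_⟩
    · rcases Int.units_eq_one_or e with rfl | rfl
      · rfl
      · simp at hl'
        omega
    · have h2 := h (l.succAbove j)
      have := val_insertEntry_succAbove l v e σ j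
      have := coe_succAbove v (σ.1 j)
      have := coe_succAbove l j
      push_cast at *
      omega
  · rintro ⟨rfl, hi, h⟩
    have hval : val (insertEntry i v 1 σ) i = k + 1 := by
      rw [val_insertEntry_same, hv]
      simp
    refine ⟨fun l hl => ?_, fun h' => ?_⟩
    · by_cases hne : l = i
      · subst hne
        rw [hval]
        simp
      · obtain ⟨j, rfl⟩ := Fin.exists_succAbove_eq hne
        have := val_insertEntry_succAbove i v 1 σ j
        have := coe_succAbove v (σ.1 j)
        have := coe_succAbove i j
        have := h j
        push_cast at *
        omega
    · have := h' i hi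
      omega

/-- The new entry crosses exactly the entries at positions strictly between `k + 1` and its own: by
the bound these have smaller values, giving the third pattern. -/
theorem weight_insertEntry_drop {R : Type*} [CommRing R] (p s q : R) (hv : (v : ℕ) = k)
    (hi : k < (i : ℕ)) (h : Bounded (k + 1) k σ) :
    weight p s q (insertEntry i v 1 σ) = q ^ ((i : ℕ) - (k + 1)) * weight p s q σ := by
  have hval : val (insertEntry i v 1 σ) i = k + 1 := by
    rw [val_insertEntry_same, hv]
    simp
  have hpos (l : ℕ) (x : Fin l) : pos x = (x : ℕ) + 1 := rfl
  have hw : wex (insertEntry i v 1 σ) = wex σ := by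
    rw [wex_insertEntry, hval, if_neg, zero_add]
    · rw [hpos]
      omega
    · intro j
      have := val_insertEntry_succAbove i v 1 σ j
      have := coe_succAbove v (σ.1 j)
      have := coe_succAbove i j
      have := h j
      rw [hpos, hpos]
      omega
  have hn : neg (insertEntry i v 1 σ) = neg σ := by
    rw [neg_insertEntry, if_neg (by decide), zero_add]
  have hc : cro (insertEntry i v 1 σ) = ((i : ℕ) - (k + 1)) + cro σ := by
    rw [cro_insertEntry i v 1 σ (fun j => k + 1 ≤ (j : ℕ) ∧ (j : ℕ) < i) (fun _ => False),
      card_filter_fin _ _ _ (by omega)]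
    · simp
    · intro j
      have := val_insertEntry_succAbove i v 1 σ j
      have := coe_succAbove v (σ.1 j)
      have := coe_succAbove i j
      have := h j
      rw [IsCrossing, hval, hpos, hpos]
      omega
    · intro j
      have := val_insertEntry_succAbove i v 1 σ j
      have := coe_succAbove v (σ.1 j)
      have := coe_succAbove i j
      have := h j
      rw [IsCrossing, hval, hpos, hpos, iff_false]
      omega
    · intro j l
      have := val_insertEntry_succAbove i v 1 σ j
      have := coe_succAbove v (σ.1 j)
      have := coe_succAbove i j
      have := h j
      have := coe_succAbove i l
      have := h l
      apply isCrossing_insertEntry <;> simp only [hpos] <;> omega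
  rw [weight, weight, hw, hn, hc, pow_add]
  ring

end DropValue

section ExcedancePosition

/-! Inserting a weak excedance at the position `k + 1`. -/

variable {k : ℕ} (i v : Fin (m + 1)) (σ : SignedPerm m)

theorem bounded_insertEntry_excedance (e : ℤˣ) (hi : (i : ℕ) = k) :
    (Bounded (k + 1) k (insertEntry i v e σ) ∧ ¬ Bounded k k (insertEntry i v e σ)) ↔
      e = 1 ∧ k ≤ (v : ℕ) ∧ Bounded k k σ := by
  constructor
  · rintro ⟨h, h'⟩
    simp only [Bounded, not_forall] at h'
    obtain ⟨l, hl, hl'⟩ := h'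
    have hli : l = i := by
      by_contra hne
      have h1 := h l
      have : (l : ℕ) ≠ i := fun h => hne (Fin.ext h)
      omega
    subst hli
    rw [val_insertEntry_same] at hl'
    have he : e = 1 := by
      rcases Int.units_eq_one_or e with rfl | rfl
      · rfl
      · simp at hl'
        omega
    subst he
    refine ⟨rfl, ?_, fun j hj => ?_⟩
    · simp at hl'
      omega
    · have h2 := h (l.succAbove j)
      have := val_insertEntry_succAbove l v 1 σ j
      have := coe_succAbove v (σ.1 j)
      have := coe_succAbove l j
      omega
  · rintro ⟨rfl, hv, h⟩
    have hval : val (insertEntry i v 1 σ) i = v + 1 := by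
      rw [val_insertEntry_same]
      simp
    refine ⟨fun l hl => ?_, fun h' => ?_⟩
    · have hne : l ≠ i := by
        rintro rfl
        omega
      obtain ⟨j, rfl⟩ := Fin.exists_succAbove_eq hne
      have := val_insertEntry_succAbove i v 1 σ j
      have := coe_succAbove v (σ.1 j)
      have := coe_succAbove i j
      have := h j
      omega
    · have := h' i hi.ge
      omega

/-- The new entry crosses exactly the entries with absolute value from `k + 1` to `v`. A positive
one lies at an earlier position by the bound and gives the first pattern; a negative one gives the
second, wherever it is. -/
theorem weight_insertEntry_excedance {R : Type*} [CommRing R] (p s q : R) (hi : (i : ℕ) = k)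
    (hv : k ≤ (v : ℕ)) (h : Bounded k k σ) :
    weight p s q (insertEntry i v 1 σ) = p * q ^ ((v : ℕ) - k) * weight p s q σ := by
  have hval : val (insertEntry i v 1 σ) i = v + 1 := by
    rw [val_insertEntry_same]
    simp
  have hpos (l : ℕ) (x : Fin l) : pos x = (x : ℕ) + 1 := rfl
  have hw : wex (insertEntry i v 1 σ) = 1 + wex σ := by
    rw [wex_insertEntry, hval, if_pos]
    · rw [hpos]
      omega
    · intro j
      have := val_insertEntry_succAbove i v 1 σ j
      have := coe_succAbove v (σ.1 j)
      have := coe_succAbove i j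
      have := h j
      rw [hpos, hpos]
      omega
  have hn : neg (insertEntry i v 1 σ) = neg σ := by
    rw [neg_insertEntry, if_neg (by decide), zero_add]
  have hc : cro (insertEntry i v 1 σ) = ((v : ℕ) - k) + cro σ := by
    rw [cro_insertEntry i v 1 σ (fun _ => False)
      (fun j => k ≤ (σ.1 j : ℕ) ∧ (σ.1 j : ℕ) < v), card_filter_perm _ _ _ (by omega)]
    · simp
    · intro j
      have := val_insertEntry_succAbove i v 1 σ j
      have := coe_succAbove v (σ.1 j)
      have := coe_succAbove i j
      have := h j
      rw [IsCrossing, hval, hpos, hpos, iff_false]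
      omega
    · intro j
      have := val_insertEntry_succAbove i v 1 σ j
      have := coe_succAbove v (σ.1 j)
      have := coe_succAbove i j
      have := h j
      rw [IsCrossing, hval, hpos, hpos]
      omega
    · intro j l
      have := val_insertEntry_succAbove i v 1 σ j
      have := coe_succAbove v (σ.1 j)
      have := coe_succAbove i j
      have := h j
      have := coe_succAbove i l
      have := h l
      apply isCrossing_insertEntry <;> simp only [hpos] <;> omega
  rw [weight, weight, hw, hn, hc, pow_add, pow_add]
  ring

end ExcedancePosition

section NegativeEntry

/-! Inserting a negative entry at the last position. -/

variable (i v : Fin (m + 1)) (σ : SignedPerm m)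

theorem bounded_insertEntry_negative (e : ℤˣ) :
    Bounded 0 0 (insertEntry i v e σ) ↔ e = -1 ∧ Bounded 0 0 σ := by
  constructor
  · intro h
    constructor
    · have h1 := h i (Nat.zero_le _)
      rw [val_insertEntry_same] at h1
      rcases Int.units_eq_one_or e with rfl | rfl
      · simp at h1
        omega
      · rfl
    · intro j _
      have h1 := h (i.succAbove j) (Nat.zero_le _)
      have := val_insertEntry_succAbove i v e σ j
      push_cast at *
      omega
  · rintro ⟨rfl, h⟩ l -
    by_cases hne : l = i
    · subst hne
      rw [val_insertEntry_same]
      simp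
    · obtain ⟨j, rfl⟩ := Fin.exists_succAbove_eq hne
      have := val_insertEntry_succAbove i v (-1) σ j
      have := h j (Nat.zero_le _)
      push_cast at *
      omega

/-- All entries are negative and the new one is last, so it crosses, by the third pattern, exactly
those of larger absolute value. -/
theorem weight_insertEntry_negative {R : Type*} [CommRing R] (p s q : R) (hi : (i : ℕ) = m)
    (h : Bounded 0 0 σ) :
    weight p s q (insertEntry i v (-1) σ) = s * q ^ (m - (v : ℕ)) * weight p s q σ := by
  have hval : val (insertEntry i v (-1) σ) i = -(v + 1) := by
    rw [val_insertEntry_same]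
    simp
  have hpos (l : ℕ) (x : Fin l) : pos x = (x : ℕ) + 1 := rfl
  have hw : wex (insertEntry i v (-1) σ) = wex σ := by
    rw [wex_insertEntry, hval, if_neg, zero_add]
    · rw [hpos]
      omega
    · intro j
      have := val_insertEntry_succAbove i v (-1) σ j
      have := coe_succAbove v (σ.1 j)
      have := coe_succAbove i j
      have := h j (Nat.zero_le _)
      push_cast at *
      rw [hpos, hpos]
      omega
  have hn : neg (insertEntry i v (-1) σ) = 1 + neg σ := by
    rw [neg_insertEntry, if_pos rfl]
  have hc : cro (insertEntry i v (-1) σ) = (m - (v : ℕ)) + cro σ := by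
    rw [cro_insertEntry i v (-1) σ (fun j => (v : ℕ) ≤ (σ.1 j : ℕ) ∧ (σ.1 j : ℕ) < m)
      (fun _ => False), card_filter_perm _ _ _ le_rfl]
    · simp
    · intro j
      have := val_insertEntry_succAbove i v (-1) σ j
      have := coe_succAbove v (σ.1 j)
      have := coe_succAbove i j
      have := h j (Nat.zero_le _)
      push_cast at *
      rw [IsCrossing, hval, hpos, hpos]
      omega
    · intro j
      have := val_insertEntry_succAbove i v (-1) σ j
      have := coe_succAbove v (σ.1 j)
      have := coe_succAbove i j
      have := h j (Nat.zero_le _)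
      push_cast at *
      rw [IsCrossing, hval, hpos, hpos, iff_false]
      omega
    · intro j l
      have := val_insertEntry_succAbove i v (-1) σ j
      have := coe_succAbove v (σ.1 j)
      have := coe_succAbove i j
      have := h j (Nat.zero_le _)
      have := coe_succAbove i l
      have := h l (Nat.zero_le _)
      push_cast at *
      apply isCrossing_insertEntry <;> simp only [hpos] <;> omega
  rw [weight, weight, hw, hn, hc, pow_add, pow_add]
  ring

end NegativeEntry

/-! ### Recurrences for bounded signed permutations. -/

section Recurrence

variable {R : Type*} [CommRing R] (p s q : R)

theorem sum_ite_and_not {α : Type*} [Fintype α] (P Q : α → Prop) [DecidablePred P]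
    [DecidablePred Q] (h : ∀ x, Q x → P x) (f : α → R) :
    (∑ x, if P x then f x else 0) =
      (∑ x, if Q x then f x else 0) + ∑ x, if P x ∧ ¬ Q x then f x else 0 := by
  rw [← Finset.sum_add_distrib]
  refine Finset.sum_congr rfl fun x _ => ?_
  have := h x
  by_cases hP : P x <;> by_cases hQ : Q x <;> simp_all

theorem sum_fin_ite_pow (n k : ℕ) :
    (∑ i : Fin n, if k ≤ (i : ℕ) then q ^ ((i : ℕ) - k) else 0) = qInt q (n - k) := by
  rw [Fin.sum_univ_eq_sum_range (fun i => if k ≤ i then q ^ (i - k) else 0), qInt]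
  rcases le_total k n with h | h
  · obtain ⟨l, rfl⟩ := Nat.exists_eq_add_of_le h
    rw [Finset.sum_range_add, Finset.sum_eq_zero, zero_add]
    · simp
    · intro i hi
      rw [Finset.mem_range] at hi
      rw [if_neg (by omega)]
  · rw [Nat.sub_eq_zero_of_le h, Finset.range_zero, Finset.sum_empty, Finset.sum_eq_zero]
    intro i hi
    rw [Finset.mem_range] at hi
    split_ifs
    · omega
    · rfl

/-- Condition and weight both split between the free coordinate of the inserted entry and the
smaller permutation, so the sum factors. `P` fixes either the position or the absolute value of that
entry. -/
theorem sum_insertEntry (P : Fin (m + 1) → ℤˣ → SignedPerm m → SignedPerm (m + 1)) (e₀ : ℤˣ)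
    (hP : Function.Bijective fun x : Fin (m + 1) × ℤˣ × SignedPerm m => P x.1 x.2.1 x.2.2)
    (A : SignedPerm (m + 1) → Prop) (B : Fin (m + 1) → Prop) (C : SignedPerm m → Prop)
    [DecidablePred A] [DecidablePred B] [DecidablePred C]
    (hA : ∀ i e σ, A (P i e σ) ↔ e = e₀ ∧ B i ∧ C σ)
    (f : SignedPerm (m + 1) → R) (g : Fin (m + 1) → R) (w : SignedPerm m → R)
    (hf : ∀ i σ, B i → C σ → f (P i e₀ σ) = g i * w σ) :
    (∑ τ, if A τ then f τ else 0) =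
      (∑ i, if B i then g i else 0) * ∑ σ, if C σ then w σ else 0 := by
  rw [← hP.sum_comp, Fintype.sum_prod_type, Finset.sum_mul]
  refine Finset.sum_congr rfl fun i _ => ?_
  rw [Fintype.sum_prod_type, Finset.sum_eq_single e₀ _ (fun h => absurd (Finset.mem_univ _) h),
    Finset.mul_sum]
  · refine Finset.sum_congr rfl fun σ _ => ?_
    simp only [hA]
    by_cases hB : B i <;> by_cases hC : C σ <;> simp [hB, hC]
    exact hf i σ hB hC
  · intro e _ he
    refine Finset.sum_eq_zero fun σ _ => ?_
    simp only [hA]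
    rw [if_neg (by tauto)]

theorem boundedSum_value (k m : ℕ) (h : k ≤ m) :
    boundedSum p s q (k + 1) (k + 1) (m + 1) =
      boundedSum p s q (k + 1) k (m + 1) + qInt q (m - k) * boundedSum p s q (k + 1) k m := by
  unfold boundedSum
  rw [sum_ite_and_not _ (Bounded (k + 1) k)]
  · congr 1
    have hv : ((⟨k, by omega⟩ : Fin (m + 1)) : ℕ) = k := rfl
    rw [sum_insertEntry _ 1 (insertEntry_bijective_of_value ⟨k, by omega⟩) _
      (fun i => k + 1 ≤ (i : ℕ)) (Bounded (k + 1) k)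
      (fun i e σ => bounded_insertEntry_drop i _ σ e hv) _
      (fun i => q ^ ((i : ℕ) - (k + 1))) (weight p s q)
      (fun i σ hi hσ => weight_insertEntry_drop i _ σ p s q hv hi hσ)]
    rw [sum_fin_ite_pow, Nat.add_sub_add_right]
  · intro π hπ i hi
    have := hπ i hi
    push_cast
    omega

theorem boundedSum_position (k m : ℕ) (h : k ≤ m) :
    boundedSum p s q (k + 1) k (m + 1) =
      boundedSum p s q k k (m + 1) + p * qInt q (m + 1 - k) * boundedSum p s q k k m := by
  unfold boundedSum
  rw [sum_ite_and_not _ (Bounded k k)]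
  · congr 1
    have hi : ((⟨k, by omega⟩ : Fin (m + 1)) : ℕ) = k := rfl
    rw [sum_insertEntry _ 1 (insertEntry_bijective_of_position ⟨k, by omega⟩) _
      (fun v => k ≤ (v : ℕ)) (Bounded k k)
      (fun v e σ => bounded_insertEntry_excedance _ v σ e hi) _
      (fun v => p * q ^ ((v : ℕ) - k)) (weight p s q)
      (fun v σ hv hσ => weight_insertEntry_excedance _ v σ p s q hi hv hσ)]
    rw [← sum_fin_ite_pow, Finset.mul_sum Finset.univ _ p]
    congr 1
    exact Finset.sum_congr rfl fun v _ => by rw [mul_ite, mul_zero]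
  · intro π hπ i hi
    exact hπ i (by omega)

theorem boundedSum_negative (m : ℕ) :
    boundedSum p s q 0 0 (m + 1) = s * qInt q (m + 1) * boundedSum p s q 0 0 m := by
  unfold boundedSum
  rw [sum_insertEntry _ (-1) (insertEntry_bijective_of_position (Fin.last m)) _
    (fun _ => True) (Bounded 0 0)
    (fun v e σ => by rw [bounded_insertEntry_negative, true_and]) _
    (fun v => s * q ^ (m - (v : ℕ))) (weight p s q)
    (fun v σ _ hσ => weight_insertEntry_negative _ v σ p s q (Fin.val_last m) hσ)]
  congr 1
  simp only [if_true]
  rw [← Finset.mul_sum, Fin.sum_univ_eq_sum_range (fun v => q ^ (m - v)), qInt,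
    ← Finset.sum_range_reflect]
  congr 1
  refine Finset.sum_congr rfl fun j hj => ?_
  rw [Finset.mem_range] at hj
  congr 1
  omega

theorem boundedSum_eq_motzkinEnd (N : ℕ) : boundedSum p s q 0 0 N = motzkinEnd s q N := by
  induction N with
  | zero => simp [boundedSum, motzkinEnd, weight, Bounded, wex, neg, cro]
  | succ N ih =>
    rw [boundedSum_negative, ih, motzkinEnd_succ, mul_comm]

theorem boundedSum_eq_motzkinStep (k N : ℕ) :
    boundedSum p s q k k (k + N) = (motzkinStep p q)^[k] (motzkinEnd s q) N := by
  induction k generalizing N with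
  | zero => rw [zero_add, boundedSum_eq_motzkinEnd]; rfl
  | succ k ih =>
    rw [Function.iterate_succ_apply', motzkinStep, excedanceOp, dropOp, ← ih, ← ih,
      show k + 1 + N = k + N + 1 by omega, boundedSum_value _ _ _ _ _ (by omega),
      boundedSum_position _ _ _ _ _ (by omega),
      show k + N + 1 - k = N + 1 by omega, show k + N - k = N by omega,
      show k + N + 1 = k + (N + 1) by omega]
    -- For `N = 0` there is no smaller size to which `boundedSum_position` could apply a second
    -- time, but that term carries the factor `qInt q 0 = 0`.
    rcases N with _ | N
    · rw [← ih]
      simp only [zero_add, add_zero, qInt_zero]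
      ring
    · rw [← add_assoc k N 1, boundedSum_position _ _ _ _ _ (by omega), ← ih,
        show k + N + 1 - k = N + 1 by omega, Nat.add_sub_cancel]
      ring

theorem sum_weight (n : ℕ) :
    ∑ π : SignedPerm n, weight p s q π = (motzkinStep p q)^[n] (motzkinEnd s q) 0 := by
  rw [← boundedSum_eq_motzkinStep, boundedSum]
  refine Finset.sum_congr rfl fun π _ => ?_
  rw [if_pos]
  intro i hi
  omega

end Recurrence

end SignedPerm

/-! ### Ferrers diagrams: adding an empty row or a full column. -/

namespace FerrersDiagram

theorem eq_of_mem_iff {F G : FerrersDiagram} (hr : F.rows = G.rows) (hc : F.cols = G.cols)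
    (h : ∀ i j, (i, j) ∈ F.shape ↔ (i, j) ∈ G.shape) : F = G := by
  have hs : F.shape = G.shape := by
    ext ⟨i, j⟩
    exact h i j
  cases F
  cases G
  simp only at hr hc hs
  subst hr hc hs
  rfl

/-- Add an empty row at the bottom. -/
def addRow (F : FerrersDiagram) : FerrersDiagram where
  rows := F.rows + 1
  cols := F.cols
  shape := F.shape
  row_lt i j h := (F.row_lt i j h).trans (Nat.lt_succ_self _)
  col_lt := F.col_lt

/-- Add a column on the left that has a cell in every row. -/
def addColumn (F : FerrersDiagram) : FerrersDiagram where
  rows := F.rows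
  cols := F.cols + 1
  shape :=
    { cells := (Finset.range F.rows).image (fun i => (i, 0)) ∪
        F.shape.cells.image (fun c => (c.1, c.2 + 1))
      isLowerSet := by
        rintro ⟨i, j⟩ ⟨i', j'⟩ h hij
        obtain ⟨hi, hj⟩ : i' ≤ i ∧ j' ≤ j := h
        simp only [Finset.coe_union, Finset.coe_image, Set.mem_union, Set.mem_image,
          Finset.mem_coe, Finset.mem_range, Prod.mk.injEq, Prod.exists,
          YoungDiagram.mem_cells] at hij ⊢
        rcases hij with ⟨a, ha, rfl, rfl⟩ | ⟨a, b, hab, rfl, rfl⟩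
        · exact Or.inl ⟨i', by omega, rfl, by omega⟩
        · rcases j' with _ | j'
          · exact Or.inl ⟨i', hi.trans_lt (F.row_lt _ _ hab), rfl, rfl⟩
          · exact Or.inr ⟨i', j', F.shape.up_left_mem hi (by omega) hab, rfl, rfl⟩ }
  row_lt i j h := by
    rw [← YoungDiagram.mem_cells] at h
    simp only [Finset.mem_union, Finset.mem_image, Finset.mem_range, Prod.mk.injEq, Prod.exists,
      YoungDiagram.mem_cells] at h
    rcases h with ⟨a, ha, rfl, rfl⟩ | ⟨a, b, hab, rfl, rfl⟩
    · exact ha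
    · exact F.row_lt _ _ hab
  col_lt i j h := by
    rw [← YoungDiagram.mem_cells] at h
    simp only [Finset.mem_union, Finset.mem_image, Finset.mem_range, Prod.mk.injEq, Prod.exists,
      YoungDiagram.mem_cells] at h
    rcases h with ⟨a, ha, rfl, rfl⟩ | ⟨a, b, hab, rfl, rfl⟩
    · omega
    · have := F.col_lt _ _ hab
      omega

theorem mem_addColumn_zero (F : FerrersDiagram) (i : ℕ) :
    (i, 0) ∈ F.addColumn.shape ↔ i < F.rows := by
  rw [← YoungDiagram.mem_cells]
  simp [addColumn]

theorem mem_addColumn_succ (F : FerrersDiagram) (i j : ℕ) :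
    (i, j + 1) ∈ F.addColumn.shape ↔ (i, j) ∈ F.shape := by
  rw [← YoungDiagram.mem_cells]
  simp [addColumn]

theorem shiftedCell_addColumn_zero (F : FerrersDiagram) (i : ℕ) :
    F.addColumn.ShiftedCell i 0 ↔ i < F.length + 1 := by
  simp only [ShiftedCell, mem_addColumn_zero, length]
  change (i < F.cols + 1 ∧ _) ∨ (∃ r, i = F.cols + 1 + r ∧ _) ↔ _
  constructor
  · rintro (⟨h, -⟩ | ⟨r, h, h'⟩) <;> omega
  · intro h
    rcases lt_or_ge i (F.cols + 1) with h' | h'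
    · exact Or.inl ⟨h', Nat.zero_le _⟩
    · exact Or.inr ⟨i - (F.cols + 1), by omega, by omega⟩

theorem not_shiftedCell_addColumn (F : FerrersDiagram) (j : ℕ) :
    ¬ F.addColumn.ShiftedCell 0 (j + 1) := by
  rintro (⟨-, h⟩ | ⟨r, h, -⟩)
  · omega
  · change 0 = F.cols + 1 + r at h
    omega

theorem shiftedCell_addColumn_succ (F : FerrersDiagram) (i j : ℕ) :
    F.addColumn.ShiftedCell (i + 1) (j + 1) ↔ F.ShiftedCell i j := by
  simp only [ShiftedCell, mem_addColumn_succ]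
  change (i + 1 < F.cols + 1 ∧ _) ∨ (∃ r, i + 1 = F.cols + 1 + r ∧ _) ↔ _
  constructor
  · rintro (⟨h, h'⟩ | ⟨r, h, h'⟩)
    · exact Or.inl ⟨by omega, by omega⟩
    · exact Or.inr ⟨r, by omega, h'⟩
  · rintro (⟨h, h'⟩ | ⟨r, h, h'⟩)
    · exact Or.inl ⟨by omega, by omega⟩
    · exact Or.inr ⟨r, by omega, h'⟩

theorem diagonalCell_addColumn_succ (F : FerrersDiagram) (i j : ℕ) :
    F.addColumn.DiagonalCell (i + 1) (j + 1) ↔ F.DiagonalCell i j := by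
  change i + 1 < F.cols + 1 ∧ j + 1 = i + 1 ↔ i < F.cols ∧ j = i
  omega

theorem diagonalCell_addColumn_zero (F : FerrersDiagram) (i : ℕ) :
    F.addColumn.DiagonalCell i 0 ↔ i = 0 := by
  change i < F.cols + 1 ∧ 0 = i ↔ i = 0
  omega

theorem exists_eq_addRow (F : FerrersDiagram) (hr : 0 < F.rows)
    (h : (F.rows - 1, 0) ∉ F.shape) : ∃ G : FerrersDiagram, F = G.addRow := by
  refine ⟨⟨F.rows - 1, F.cols, F.shape, fun i j hij => ?_, F.col_lt⟩,
    eq_of_mem_iff ?_ rfl fun _ _ => Iff.rfl⟩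
  · have := F.row_lt i j hij
    by_contra hi
    exact h (F.shape.up_left_mem (by omega) (Nat.zero_le j) hij)
  · change F.rows = F.rows - 1 + 1
    omega

theorem exists_eq_addColumn (F : FerrersDiagram) (hl : 0 < F.length)
    (h : 0 < F.rows → (F.rows - 1, 0) ∈ F.shape) : ∃ G : FerrersDiagram, F = G.addColumn := by
  have hc : 0 < F.cols := by
    rcases Nat.eq_zero_or_pos F.rows with h0 | h0
    · rw [length] at hl
      omega
    · exact F.col_lt _ _ (h h0)
  let S : YoungDiagram :=
    { cells := (Finset.range F.rows ×ˢ Finset.range F.cols).filter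
        (fun c => (c.1, c.2 + 1) ∈ F.shape.cells)
      isLowerSet := by
        rintro ⟨i, j⟩ ⟨i', j'⟩ h hij
        obtain ⟨hi, hj⟩ : i' ≤ i ∧ j' ≤ j := h
        simp only [Finset.coe_filter, Finset.mem_product, Finset.mem_range, Set.mem_ofPred_eq,
          YoungDiagram.mem_cells] at hij ⊢
        exact ⟨⟨by omega, by omega⟩, F.shape.up_left_mem hi (by omega) hij.2⟩ }
  have hS (i j : ℕ) : (i, j) ∈ S ↔ (i, j + 1) ∈ F.shape := by
    rw [← YoungDiagram.mem_cells]
    simp only [S, Finset.mem_filter, Finset.mem_product, Finset.mem_range,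
      YoungDiagram.mem_cells, and_iff_right_iff_imp]
    intro hij
    have := F.row_lt _ _ hij
    have := F.col_lt _ _ hij
    omega
  refine ⟨⟨F.rows, F.cols - 1, S, fun i j hij => F.row_lt _ _ ((hS i j).1 hij), fun i j hij => ?_⟩,
    eq_of_mem_iff rfl ?_ fun i j => ?_⟩
  · have := F.col_lt _ _ ((hS i j).1 hij)
    omega
  · change F.cols = F.cols - 1 + 1
    omega
  · rcases j with _ | j
    · rw [mem_addColumn_zero]
      refine ⟨F.row_lt i 0, fun hi => ?_⟩
      change i < F.rows at hi
      exact F.shape.up_left_mem (by omega) le_rfl (h (by omega))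
    · rw [mem_addColumn_succ, hS]

theorem addRow_injective : Function.Injective addRow := by
  intro F G h
  refine eq_of_mem_iff ?_ (congrArg (fun H => H.cols) h) fun i j => ?_
  · have : F.rows + 1 = G.rows + 1 := congrArg (fun H => H.rows) h
    omega
  · change (i, j) ∈ F.addRow.shape ↔ (i, j) ∈ G.addRow.shape
    rw [h]

theorem addColumn_injective : Function.Injective addColumn := by
  intro F G h
  refine eq_of_mem_iff (congrArg (fun H => H.rows) h) ?_ fun i j => ?_
  · have : F.cols + 1 = G.cols + 1 := congrArg (fun H => H.cols) h
    omega
  · rw [← mem_addColumn_succ, h, mem_addColumn_succ]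

end FerrersDiagram

/-! ### Tableaux: unique decomposition by the last row or column added. -/

namespace TypeBTableau

variable {n : ℕ}

theorem eq_of_diagram_ones {T T' : TypeBTableau n} (hd : T.diagram = T'.diagram)
    (ho : T.ones = T'.ones) : T = T' := by
  cases T
  cases T'
  simp only at hd ho
  subst hd ho
  rfl

/-- A row is restricted if no further `1` can be put to the left of it. -/
def Restricted (T : TypeBTableau n) (i : ℕ) : Prop :=
  ∃ j, T.diagram.ShiftedCell i j ∧ (i, j) ∉ T.ones ∧
    ((∃ i' < i, (i', j) ∈ T.ones) ∨ T.diagram.DiagonalCell i j)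

open Classical in
/-- The set of unrestricted rows. -/
noncomputable def unrestricted (T : TypeBTableau n) : Finset ℕ :=
  (Finset.range n).filter fun i => ¬ T.Restricted i

theorem mem_unrestricted {T : TypeBTableau n} {i : ℕ} :
    i ∈ T.unrestricted ↔ i < n ∧ ¬ T.Restricted i := by
  simp [unrestricted]

/-- The rows in which a new column may contain a `1`. -/
noncomputable def admissible (T : TypeBTableau n) : Finset ℕ :=
  insert 0 (T.unrestricted.image Nat.succ)

theorem succ_mem_admissible {T : TypeBTableau n} {i : ℕ} :
    i + 1 ∈ T.admissible ↔ i ∈ T.unrestricted := by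
  simp [admissible]

/-- The tableau with an empty row added at the bottom. -/
def addRow (T : TypeBTableau n) : TypeBTableau (n + 1) where
  diagram := T.diagram.addRow
  length_eq := by
    have := T.length_eq
    change T.diagram.rows + 1 + T.diagram.cols = n + 1
    rw [FerrersDiagram.length] at this
    omega
  ones := T.ones
  ones_cell := T.ones_cell
  column_one := T.column_one
  zero_cond := T.zero_cond
  diag_cond := T.diag_cond

/-- The positions of the `1`'s after a column on the left is added. -/
def shiftOnes (O : Finset (ℕ × ℕ)) (C : Finset ℕ) : Finset (ℕ × ℕ) :=
  C.image (fun i => (i, 0)) ∪ O.image (fun c => (c.1 + 1, c.2 + 1))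

variable {O : Finset (ℕ × ℕ)} {C : Finset ℕ} {i j : ℕ}

@[simp] theorem mem_shiftOnes_zero : (i, 0) ∈ shiftOnes O C ↔ i ∈ C := by
  simp [shiftOnes]

@[simp] theorem not_mem_shiftOnes : (0, j + 1) ∉ shiftOnes O C := by
  simp [shiftOnes]

@[simp] theorem mem_shiftOnes_succ : (i + 1, j + 1) ∈ shiftOnes O C ↔ (i, j) ∈ O := by
  simp [shiftOnes]

theorem exists_above_shiftOnes_zero :
    (∃ i' < i, (i', 0) ∈ shiftOnes O C) ↔ ∃ c < i, c ∈ C := by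
  simp

theorem exists_above_shiftOnes_succ :
    (∃ i' < i + 1, (i', j + 1) ∈ shiftOnes O C) ↔ ∃ i' < i, (i', j) ∈ O := by
  constructor
  · rintro ⟨_ | i', h, h'⟩
    · exact absurd h' not_mem_shiftOnes
    · exact ⟨i', by omega, mem_shiftOnes_succ.1 h'⟩
  · rintro ⟨i', h, h'⟩
    exact ⟨i' + 1, by omega, mem_shiftOnes_succ.2 h'⟩

theorem exists_left_shiftOnes :
    (∃ j' < j + 1, (i + 1, j') ∈ shiftOnes O C) ↔ i + 1 ∈ C ∨ ∃ j' < j, (i, j') ∈ O := by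
  constructor
  · rintro ⟨_ | j', h, h'⟩
    · exact Or.inl (mem_shiftOnes_zero.1 h')
    · exact Or.inr ⟨j', by omega, mem_shiftOnes_succ.1 h'⟩
  · rintro (h | ⟨j', h, h'⟩)
    · exact ⟨0, by omega, mem_shiftOnes_zero.2 h⟩
    · exact ⟨j' + 1, by omega, mem_shiftOnes_succ.2 h'⟩

/-- The tableau with a column added on the left, whose `1`'s are in the rows in `C`. -/
def addColumn (T : TypeBTableau n) (C : Finset ℕ) (hC : C ⊆ T.admissible) (hne : C.Nonempty) :
    TypeBTableau (n + 1) where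
  diagram := T.diagram.addColumn
  length_eq := by
    have := T.length_eq
    change T.diagram.rows + (T.diagram.cols + 1) = n + 1
    rw [FerrersDiagram.length] at this
    omega
  ones := shiftOnes T.ones C
  ones_cell i j h := by
    rcases j with _ | j
    · rw [FerrersDiagram.shiftedCell_addColumn_zero, T.length_eq]
      rcases i with _ | i
      · omega
      · have := mem_unrestricted.1 (succ_mem_admissible.1 (hC (mem_shiftOnes_zero.1 h)))
        omega
    · rcases i with _ | i
      · exact absurd h not_mem_shiftOnes
      · exact (FerrersDiagram.shiftedCell_addColumn_succ _ _ _).2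
          (T.ones_cell _ _ (mem_shiftOnes_succ.1 h))
  column_one j hj := by
    rcases j with _ | j
    · obtain ⟨i, hi⟩ := hne
      exact ⟨i, mem_shiftOnes_zero.2 hi⟩
    · obtain ⟨i, hi⟩ := T.column_one j (Nat.lt_of_succ_lt_succ hj)
      exact ⟨i + 1, mem_shiftOnes_succ.2 hi⟩
  zero_cond i j hc ho := by
    rintro ⟨hu, hl⟩
    rcases j with _ | j
    · obtain ⟨j', hj', -⟩ := hl
      omega
    · rcases i with _ | i
      · obtain ⟨i', hi', -⟩ := hu
        omega
      · rw [exists_above_shiftOnes_succ] at hu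
        rw [exists_left_shiftOnes] at hl
        rw [FerrersDiagram.shiftedCell_addColumn_succ] at hc
        rw [mem_shiftOnes_succ] at ho
        rcases hl with hl | hl
        · exact (mem_unrestricted.1 (succ_mem_admissible.1 (hC hl))).2 ⟨j, hc, ho, Or.inl hu⟩
        · exact T.zero_cond i j hc ho ⟨hu, hl⟩
  diag_cond i j hc ho hl := by
    rcases j with _ | j
    · obtain ⟨j', hj', -⟩ := hl
      omega
    · rcases i with _ | i
      · have : j + 1 = 0 := hc.2
        omega
      · rw [exists_left_shiftOnes] at hl
        rw [FerrersDiagram.diagonalCell_addColumn_succ] at hc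
        rw [mem_shiftOnes_succ] at ho
        rcases hl with hl | hl
        · exact (mem_unrestricted.1 (succ_mem_admissible.1 (hC hl))).2
            ⟨j, Or.inl ⟨hc.1, hc.2.le⟩, ho, Or.inr hc⟩
        · exact T.diag_cond i j hc ho hl

/-- The sets of rows that the `1`'s of a new column may occupy. -/
noncomputable def columnSets (T : TypeBTableau n) : Finset (Finset ℕ) :=
  T.admissible.powerset.filter fun C => C.Nonempty

theorem mem_columnSets {T : TypeBTableau n} :
    C ∈ T.columnSets ↔ C ⊆ T.admissible ∧ C.Nonempty := by
  simp [columnSets]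

/-- Extend a tableau by an empty row or by a column. -/
def extend : TypeBTableau n ⊕ (Σ T : TypeBTableau n, T.columnSets) → TypeBTableau (n + 1)
  | Sum.inl T => T.addRow
  | Sum.inr ⟨T, C⟩ => T.addColumn C (mem_columnSets.1 C.2).1 (mem_columnSets.1 C.2).2

/-- The bottom row is empty after the one operation, while after the other every original row has a
leftmost cell. -/
theorem addRow_ne_addColumn (T T' : TypeBTableau n) (hC : C ⊆ T'.admissible)
    (hne : C.Nonempty) : T.addRow ≠ T'.addColumn C hC hne := by
  intro h
  have hd : T.diagram.addRow = T'.diagram.addColumn := congrArg diagram h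
  have h1 : T.diagram.rows + 1 = T'.diagram.rows := congrArg FerrersDiagram.rows hd
  have h2 : (T.diagram.rows, 0) ∈ T.diagram.addRow.shape := by
    rw [hd, FerrersDiagram.mem_addColumn_zero]
    omega
  exact lt_irrefl _ (T.diagram.row_lt _ _ h2)

theorem addRow_injective : Function.Injective (addRow : TypeBTableau n → _) := by
  intro T T' h
  exact eq_of_diagram_ones (FerrersDiagram.addRow_injective (congrArg diagram h))
    (show T.addRow.ones = T'.addRow.ones by rw [h])

theorem addColumn_injective {T T' : TypeBTableau n} {C C' : Finset ℕ} {hC : C ⊆ T.admissible}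
    {hne : C.Nonempty} {hC' : C' ⊆ T'.admissible} {hne' : C'.Nonempty}
    (h : T.addColumn C hC hne = T'.addColumn C' hC' hne') : T = T' ∧ C = C' := by
  have ho : shiftOnes T.ones C = shiftOnes T'.ones C' := congrArg ones h
  refine ⟨eq_of_diagram_ones (FerrersDiagram.addColumn_injective (congrArg diagram h)) ?_, ?_⟩
  · ext ⟨i, j⟩
    rw [← mem_shiftOnes_succ (C := C), ho, mem_shiftOnes_succ]
  · ext i
    rw [← mem_shiftOnes_zero (O := T.ones), ho, mem_shiftOnes_zero]

theorem exists_eq_addRow (T : TypeBTableau (n + 1)) {G : FerrersDiagram}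
    (hG : T.diagram = G.addRow) : ∃ T' : TypeBTableau n, T'.addRow = T := by
  obtain ⟨d, hl, o, h1, h2, h3, h4⟩ := T
  simp only at hG
  subst hG
  refine ⟨⟨G, ?_, o, h1, h2, h3, h4⟩, rfl⟩
  change G.rows + 1 + G.cols = n + 1 at hl
  rw [FerrersDiagram.length]
  omega

theorem exists_eq_addColumn (T : TypeBTableau (n + 1)) {G : FerrersDiagram}
    (hG : T.diagram = G.addColumn) :
    ∃ (T' : TypeBTableau n) (C : Finset ℕ) (hC : C ⊆ T'.admissible) (hne : C.Nonempty),
      T'.addColumn C hC hne = T := by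
  obtain ⟨d, hl, o, h1, h2, h3, h4⟩ := T
  simp only at hG
  subst hG
  have hl' : G.length = n := by
    change G.rows + (G.cols + 1) = n + 1 at hl
    rw [FerrersDiagram.length]
    omega
  have hlt (i : ℕ) (hi : (i, 0) ∈ o) : i < n + 1 := by
    have := h1 i 0 hi
    rwa [FerrersDiagram.shiftedCell_addColumn_zero, hl'] at this
  let C : Finset ℕ := (Finset.range (n + 1)).filter fun i => (i, 0) ∈ o
  have hmem (i : ℕ) : i ∈ C ↔ (i, 0) ∈ o := by
    simp only [C, Finset.mem_filter, Finset.mem_range, and_iff_right_iff_imp]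
    exact hlt i
  let O : Finset (ℕ × ℕ) := (o.filter fun c => c.2 ≠ 0).image fun c => (c.1 - 1, c.2 - 1)
  have h0 (j : ℕ) : (0, j + 1) ∉ o := fun h =>
    FerrersDiagram.not_shiftedCell_addColumn G j (h1 _ _ h)
  have hO (i j : ℕ) : (i, j) ∈ O ↔ (i + 1, j + 1) ∈ o := by
    simp only [O, Finset.mem_image, Finset.mem_filter, Prod.mk.injEq, Prod.exists]
    constructor
    · rintro ⟨_ | a, _ | b, ⟨hab, hb⟩, rfl, rfl⟩
      · exact absurd rfl hb
      · exact absurd hab (h0 _)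
      · exact absurd rfl hb
      · exact hab
    · intro h
      exact ⟨i + 1, j + 1, ⟨h, by omega⟩, rfl, rfl⟩
  have hs : shiftOnes O C = o := by
    ext ⟨i, j⟩
    rcases j with _ | j
    · rw [mem_shiftOnes_zero, hmem]
    · rcases i with _ | i
      · exact iff_of_false not_mem_shiftOnes (h0 j)
      · rw [mem_shiftOnes_succ, hO]
  -- Stated for `shiftOnes O C`, the two conditions can be transferred by the lemmas on shifted
  -- ones.
  rw [← hs] at h3 h4
  let T' : TypeBTableau n :=
    { diagram := G
      length_eq := hl'
      ones := O
      ones_cell := fun i j h => (FerrersDiagram.shiftedCell_addColumn_succ _ _ _).1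
        (h1 _ _ ((hO i j).1 h))
      column_one := fun j hj => by
        obtain ⟨i, hi⟩ := h2 (j + 1) (Nat.succ_lt_succ hj)
        rcases i with _ | i
        · exact absurd hi (h0 j)
        · exact ⟨i, (hO i j).2 hi⟩
      zero_cond := fun i j hc ho h => by
        refine h3 (i + 1) (j + 1) ((FerrersDiagram.shiftedCell_addColumn_succ _ _ _).2 hc)
          (mt mem_shiftOnes_succ.1 ho) ⟨exists_above_shiftOnes_succ.2 h.1,
            exists_left_shiftOnes.2 (Or.inr h.2)⟩
      diag_cond := fun i j hc ho h => by
        refine h4 (i + 1) (j + 1) ((FerrersDiagram.diagonalCell_addColumn_succ _ _ _).2 hc)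
          (mt mem_shiftOnes_succ.1 ho) (exists_left_shiftOnes.2 (Or.inr h)) }
  refine ⟨T', C, fun i hi => ?_, ?_, eq_of_diagram_ones rfl hs⟩
  · rcases i with _ | i
    · simp [admissible]
    · rw [succ_mem_admissible, mem_unrestricted]
      refine ⟨Nat.lt_of_succ_lt_succ (hlt _ ((hmem _).1 hi)), ?_⟩
      -- A 1 of the first column in a restricted row would stand left of the 0 that restricts the
      -- row, violating the zero condition or the diagonal condition.
      rintro ⟨j, hc, ho, hu | hd⟩
      · exact h3 (i + 1) (j + 1) ((FerrersDiagram.shiftedCell_addColumn_succ _ _ _).2 hc)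
          (mt mem_shiftOnes_succ.1 ho) ⟨exists_above_shiftOnes_succ.2 hu,
            exists_left_shiftOnes.2 (Or.inl hi)⟩
      · exact h4 (i + 1) (j + 1) ((FerrersDiagram.diagonalCell_addColumn_succ _ _ _).2 hd)
          (mt mem_shiftOnes_succ.1 ho) (exists_left_shiftOnes.2 (Or.inl hi))
  · obtain ⟨i, hi⟩ := h2 0 (Nat.succ_pos _)
    exact ⟨i, (hmem i).2 hi⟩

/-- The leftmost cell of the bottom row decides: if there is a row without it, that row is empty and
can be removed; otherwise the first column is full. -/
theorem extend_bijective : Function.Bijective (extend (n := n)) := by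
  constructor
  · rintro (T | ⟨T, C, hC⟩) (T' | ⟨T', C', hC'⟩) h
    · rw [addRow_injective h]
    · exact absurd h (addRow_ne_addColumn T T' (mem_columnSets.1 hC').1 (mem_columnSets.1 hC').2)
    · exact absurd h.symm
        (addRow_ne_addColumn T' T (mem_columnSets.1 hC).1 (mem_columnSets.1 hC).2)
    · obtain ⟨rfl, rfl⟩ := addColumn_injective (hC := (mem_columnSets.1 hC).1)
        (hne := (mem_columnSets.1 hC).2) (hC' := (mem_columnSets.1 hC').1)
        (hne' := (mem_columnSets.1 hC').2) h
      rfl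
  · intro T
    by_cases h : 0 < T.diagram.rows ∧ (T.diagram.rows - 1, 0) ∉ T.diagram.shape
    · obtain ⟨G, hG⟩ := T.diagram.exists_eq_addRow h.1 h.2
      obtain ⟨T', rfl⟩ := T.exists_eq_addRow hG
      exact ⟨Sum.inl T', rfl⟩
    · obtain ⟨G, hG⟩ := T.diagram.exists_eq_addColumn (by rw [T.length_eq]; omega)
        (fun hr => by_contra fun h' => h ⟨hr, h'⟩)
      obtain ⟨T', C, hC, hne, rfl⟩ := T.exists_eq_addColumn hG
      exact ⟨Sum.inr ⟨T', C, mem_columnSets.2 ⟨hC, hne⟩⟩, rfl⟩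

/-! ### How the statistics change under an extension. -/

section Statistics

variable (T : TypeBTableau n) (hC : C ⊆ T.admissible) (hne : C.Nonempty)

theorem row_addRow : T.addRow.row = T.row + 1 := rfl

theorem diag_addRow : T.addRow.diag = T.diag := rfl

theorem so_addRow : T.addRow.so = T.so := rfl

theorem unrestricted_addRow : T.addRow.unrestricted = insert n T.unrestricted := by
  ext i
  have hr : T.addRow.Restricted i ↔ T.Restricted i := Iff.rfl
  rw [Finset.mem_insert, mem_unrestricted, mem_unrestricted, hr]
  -- The shifted diagram has exactly `n` rows, so the index `n` has no cell to restrict it.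
  have hn : ¬ T.Restricted n := by
    have hl := T.length_eq
    rw [FerrersDiagram.length] at hl
    rintro ⟨j, ⟨h, -⟩ | ⟨r, h, h'⟩, -⟩
    · omega
    · have := T.diagram.row_lt _ _ h'
      omega
  constructor
  · rintro ⟨h, h'⟩
    rcases Nat.lt_succ_iff_lt_or_eq.1 h with h | h
    · exact Or.inr ⟨h, h'⟩
    · exact Or.inl h
  · rintro (rfl | ⟨h, h'⟩)
    · exact ⟨by omega, hn⟩
    · exact ⟨by omega, h'⟩

theorem card_unrestricted_addRow :
    T.addRow.unrestricted.card = T.unrestricted.card + 1 := by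
  rw [unrestricted_addRow, Finset.card_insert_of_notMem]
  rw [mem_unrestricted]
  simp

theorem row_addColumn : (T.addColumn C hC hne).row = T.row := rfl

theorem card_filter_shiftOnes (P : ℕ × ℕ → Prop) [DecidablePred P] :
    ((shiftOnes O C).filter P).card = (C.filter fun i => P (i, 0)).card +
      (O.filter fun c => P (c.1 + 1, c.2 + 1)).card := by
  rw [shiftOnes, Finset.filter_union, Finset.card_union_of_disjoint, Finset.filter_image,
    Finset.filter_image, Finset.card_image_of_injective, Finset.card_image_of_injective]
  · rintro ⟨a, b⟩ ⟨a', b'⟩ h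
    simpa using h
  · intro a a' h
    simpa using h
  · rw [Finset.disjoint_left]
    rintro ⟨i, j⟩ h h'
    simp only [Finset.mem_filter, Finset.mem_image, Prod.mk.injEq, Prod.exists] at h h'
    obtain ⟨⟨_, _, _, rfl⟩, _⟩ := h
    obtain ⟨⟨_, _, _, _, h⟩, _⟩ := h'
    omega

theorem diag_addColumn :
    (T.addColumn C hC hne).diag = (if 0 ∈ C then 1 else 0) + T.diag := by
  classical
  rw [diag, diag]
  change ((shiftOnes T.ones C).filter _).card = _
  rw [card_filter_shiftOnes]
  congr 1
  · change (C.filter fun i => T.diagram.addColumn.DiagonalCell i 0).card = _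
    simp only [FerrersDiagram.diagonalCell_addColumn_zero]
    rw [Finset.filter_eq']
    split_ifs <;> simp
  · congr 1
    refine Finset.filter_congr fun c _ => ?_
    exact FerrersDiagram.diagonalCell_addColumn_succ _ _ _

theorem so_addColumn : (T.addColumn C hC hne).so = (C.card - 1) + T.so := by
  classical
  rw [so, so]
  change ((shiftOnes T.ones C).filter fun c => ∃ i' < c.1, (i', c.2) ∈ shiftOnes T.ones C).card = _
  rw [card_filter_shiftOnes]
  simp only [exists_above_shiftOnes_zero, exists_above_shiftOnes_succ]
  congr 1
  -- Only the topmost 1 of the new column is not superfluous.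
  rw [← Finset.card_erase_of_mem (C.min'_mem hne)]
  congr 1
  ext c
  simp only [Finset.mem_filter, Finset.mem_erase]
  constructor
  · rintro ⟨hc, c', h, h'⟩
    refine ⟨?_, hc⟩
    have := C.min'_le c' h'
    omega
  · rintro ⟨h, hc⟩
    exact ⟨hc, C.min' hne, lt_of_le_of_ne (C.min'_le c hc) (Ne.symm h), C.min'_mem hne⟩

/-- Whether the row `i` of the column with the set `C` of `1`'s does not get restricted. -/
def KeepsRow (C : Finset ℕ) (i : ℕ) : Prop := i ∈ C ∨ (i ≠ 0 ∧ ∀ c ∈ C, i ≤ c)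

instance (C : Finset ℕ) (i : ℕ) : Decidable (KeepsRow C i) := by
  unfold KeepsRow
  infer_instance

/-- Restrictions persist. A 0 in the new column newly restricts its row if it lies below a 1 of that
column, or is the diagonal cell, which is in row `0`. -/
theorem unrestricted_addColumn :
    (T.addColumn C hC hne).unrestricted = T.admissible.filter (KeepsRow C) := by
  ext i
  rw [mem_unrestricted, Finset.mem_filter]
  rcases i with _ | i
  · have h0 : 0 ∈ T.admissible := by simp [admissible]
    have : (T.addColumn C hC hne).Restricted 0 ↔ 0 ∉ C := by
      constructor
      · rintro ⟨_ | j, hc, ho, h⟩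
        · exact mt mem_shiftOnes_zero.2 ho
        · exact absurd hc (FerrersDiagram.not_shiftedCell_addColumn _ _)
      · intro h
        refine ⟨0, ?_, mt mem_shiftOnes_zero.1 h, Or.inr ?_⟩
        · exact (FerrersDiagram.shiftedCell_addColumn_zero _ _).2 (Nat.succ_pos _)
        · exact (FerrersDiagram.diagonalCell_addColumn_zero _ _).2 rfl
    simp [this, h0, KeepsRow]
  · have : (T.addColumn C hC hne).Restricted (i + 1) ↔
        (i < n ∧ i + 1 ∉ C ∧ ∃ c < i + 1, c ∈ C) ∨ T.Restricted i := by
      constructor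
      · rintro ⟨_ | j, hc, ho, h⟩
        · have hc := (FerrersDiagram.shiftedCell_addColumn_zero _ _).1 hc
          rw [T.length_eq] at hc
          refine Or.inl ⟨by omega, mt mem_shiftOnes_zero.2 ho, ?_⟩
          rcases h with h | h
          · exact exists_above_shiftOnes_zero.1 h
          · have := (FerrersDiagram.diagonalCell_addColumn_zero _ _).1 h
            omega
        · refine Or.inr ⟨j, (FerrersDiagram.shiftedCell_addColumn_succ _ _ _).1 hc,
            mt mem_shiftOnes_succ.2 ho, ?_⟩
          exact h.imp exists_above_shiftOnes_succ.1
            (FerrersDiagram.diagonalCell_addColumn_succ _ _ _).1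
      · rintro (⟨hi, ho, h⟩ | ⟨j, hc, ho, h⟩)
        · refine ⟨0, ?_, mt mem_shiftOnes_zero.1 ho, Or.inl (exists_above_shiftOnes_zero.2 h)⟩
          refine (FerrersDiagram.shiftedCell_addColumn_zero _ _).2 ?_
          rw [T.length_eq]
          omega
        · exact ⟨j + 1, (FerrersDiagram.shiftedCell_addColumn_succ _ _ _).2 hc,
            mt mem_shiftOnes_succ.1 ho, h.imp exists_above_shiftOnes_succ.2
              (FerrersDiagram.diagonalCell_addColumn_succ _ _ _).2⟩
    rw [this, succ_mem_admissible, mem_unrestricted, KeepsRow]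
    have hk : (∃ c < i + 1, c ∈ C) ↔ ¬ ∀ c ∈ C, i + 1 ≤ c := by
      simp only [not_forall, not_le]
      exact exists_congr fun c => by rw [exists_prop, and_comm]
    rw [hk]
    have h1 : i + 1 < n + 1 ↔ i < n := by omega
    have h2 : i + 1 ≠ 0 := by omega
    tauto

end Statistics

/-! ### The tableau generating function as an iterate. -/

section Sum

variable {R : Type*} [CommRing R] (p s q : R)

/-- The weight of a new column with the set `C` of `1`'s, where the column may have `1`'s in the
rows in `A`. -/
def columnWeight (A : Finset ℕ) (φ : ℕ → R) (C : Finset ℕ) : R :=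
  if C.Nonempty then
    s ^ (if 0 ∈ C then 1 else 0) * q ^ (C.card - 1) * φ (A.filter (KeepsRow C)).card
  else 0

theorem columnWeight_insert_of_subset {A C : Finset ℕ} {a : ℕ} (ha : ∀ x ∈ A, x < a)
    (hC : C ⊆ A) (φ : ℕ → R) : columnWeight s q (insert a A) φ C = columnWeight s q A φ C := by
  unfold columnWeight
  refine ite_congr rfl (fun hne => ?_) fun _ => rfl
  have hk : ¬ KeepsRow C a := by
    obtain ⟨c, hc⟩ := hne
    have := ha c (hC hc)
    rintro (h | h)
    · exact lt_irrefl _ (ha a (hC h))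
    · have := h.2 c hc
      omega
  rw [Finset.filter_insert, if_neg hk]

theorem columnWeight_insert_insert {A C : Finset ℕ} {a : ℕ} (h0 : a ≠ 0) (ha : ∀ x ∈ A, x < a)
    (hC : C ⊆ A) (hne : C.Nonempty) (φ : ℕ → R) :
    columnWeight s q (insert a A) φ (insert a C) =
      q * columnWeight s q A (fun k => φ (k + 1)) C := by
  have haA : a ∉ A := fun h => lt_irrefl _ (ha a h)
  have haC : a ∉ C := fun h => haA (hC h)
  unfold columnWeight
  rw [if_pos hne, if_pos (Finset.insert_nonempty _ _), Finset.card_insert_of_notMem haC,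
    Finset.filter_insert,
    if_pos (show KeepsRow (insert a C) a from Or.inl (Finset.mem_insert_self _ _)),
    Finset.card_insert_of_notMem (fun h => haA (Finset.mem_filter.1 h).1)]
  have hf : A.filter (KeepsRow (insert a C)) = A.filter (KeepsRow C) := by
    refine Finset.filter_congr fun x hx => ?_
    have := ha x hx
    simp only [KeepsRow, Finset.mem_insert, forall_eq_or_imp]
    have h1 : x ≠ a := this.ne
    have h2 : x ≤ a := this.le
    tauto
  have h0' : (0 ∈ insert a C) ↔ 0 ∈ C := by
    rw [Finset.mem_insert, or_iff_right (Ne.symm h0)]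
  have hcard : C.card = C.card - 1 + 1 := by
    have := hne.card_pos
    omega
  simp only [hf, h0', Nat.add_sub_cancel]
  rw [hcard, pow_succ]
  simp only [Nat.add_sub_cancel]
  ring

/-- Induction on the lowest admissible row `a`; the three cases are the terms of `columnOp`. If `C`
is nonempty and avoids `a`, then `a` becomes restricted. If `C` contains `a` and more, then `a` is
kept and adds a superfluous 1. If `C = {a}`, every row but `0` is kept. -/
theorem sum_columnWeight (U : Finset ℕ) (hU : ∀ x ∈ U, x ≠ 0) (φ : ℕ → R) :
    ∑ C ∈ (insert 0 U).powerset, columnWeight s q (insert 0 U) φ C =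
      columnOp s q φ U.card := by
  induction U using Finset.induction_on_max generalizing φ with
  | empty =>
    rw [Finset.sum_powerset_insert (Finset.notMem_empty 0)]
    simp [columnWeight, columnOp, Finset.filter_singleton, KeepsRow]
  | insert a U ha ih =>
    have h0 : a ≠ 0 := hU a (Finset.mem_insert_self _ _)
    have hU' : ∀ x ∈ U, x ≠ 0 := fun x hx => hU x (Finset.mem_insert_of_mem hx)
    have haA : ∀ x ∈ insert 0 U, x < a := by
      intro x hx
      rcases Finset.mem_insert.1 hx with rfl | hx
      · omega
      · exact ha x hx
    have haU : a ∉ U := fun h => lt_irrefl _ (ha a h)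
    have h0U : 0 ∉ U := fun h => hU' 0 h rfl
    rw [Finset.insert_comm, Finset.sum_powerset_insert (fun h => lt_irrefl _ (haA a h)),
      Finset.card_insert_of_notMem haU, columnOp, ← ih hU' φ, ← ih hU' fun k => φ (k + 1),
      add_assoc]
    congr 1
    · exact Finset.sum_congr rfl fun C hC =>
        columnWeight_insert_of_subset s q haA (Finset.mem_powerset.1 hC) φ
    -- Among the sets `insert a C`, the term `C = ∅` is the column with its single 1 in row `a`.
    · rw [← Finset.add_sum_erase _ _ (Finset.empty_mem_powerset _), add_comm]
      congr 1
      · rw [Finset.mul_sum, ← Finset.sum_erase (insert 0 U).powerset (a := ∅)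
          (f := fun C => q * columnWeight s q (insert 0 U) (fun k => φ (k + 1)) C)
          (by simp [columnWeight])]
        refine Finset.sum_congr rfl fun C hC => ?_
        rw [Finset.mem_erase] at hC
        exact columnWeight_insert_insert s q h0 haA (Finset.mem_powerset.1 hC.2)
          (Finset.nonempty_iff_ne_empty.2 hC.1) φ
      · have hf : (insert a (insert 0 U)).filter (KeepsRow {a}) = insert a U := by
          ext x
          simp only [Finset.mem_filter, Finset.mem_insert, KeepsRow, Finset.mem_singleton,
            forall_eq]
          constructor
          · rintro ⟨rfl | rfl | h, h'⟩
            · exact Or.inl rfl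
            · omega
            · exact Or.inr h
          · rintro (rfl | h)
            · exact ⟨Or.inl rfl, Or.inl rfl⟩
            · exact ⟨Or.inr (Or.inr h), Or.inr ⟨hU' x h, (ha x h).le⟩⟩
        rw [insert_empty_eq, columnWeight, hf, Finset.card_insert_of_notMem haU]
        simp [Ne.symm h0]

/-- The generating function of the tableaux of length `n`, where `φ` weighs the number of
unrestricted rows. -/
noncomputable def tableauSum (n : ℕ) (φ : ℕ → R) : R :=
  ∑ T : TypeBTableau n, p ^ T.row * s ^ T.diag * q ^ T.so * φ T.unrestricted.card

theorem tableauSum_succ (n : ℕ) (φ : ℕ → R) :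
    tableauSum p s q (n + 1) φ = tableauSum p s q n (tableauStep p s q φ) := by
  rw [tableauSum, ← extend_bijective.sum_comp, Fintype.sum_sum_type, Fintype.sum_sigma,
    ← Finset.sum_add_distrib, tableauSum]
  refine Finset.sum_congr rfl fun T _ => ?_
  rw [tableauStep, mul_add]
  congr 1
  · simp only [extend, row_addRow, diag_addRow, so_addRow, card_unrestricted_addRow]
    ring
  · have hU : ∀ x ∈ T.unrestricted.image Nat.succ, x ≠ 0 := by
      intro x hx
      obtain ⟨y, -, rfl⟩ := Finset.mem_image.1 hx
      exact Nat.succ_ne_zero y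
    have hcard : (T.unrestricted.image Nat.succ).card = T.unrestricted.card :=
      Finset.card_image_of_injective _ Nat.succ_injective
    rw [← hcard, ← sum_columnWeight s q _ hU, ← admissible, Finset.mul_sum]
    simp only [columnWeight, mul_ite, mul_zero]
    rw [← Finset.sum_filter, ← columnSets, ← Finset.sum_coe_sort T.columnSets]
    refine Finset.sum_congr rfl fun C _ => ?_
    simp only [extend, row_addColumn, diag_addColumn, so_addColumn, unrestricted_addColumn,
      pow_add]
    ring

theorem tableauSum_zero (φ : ℕ → R) : tableauSum p s q 0 φ = φ 0 := by
  have hz (T : TypeBTableau 0) : T.diagram.rows = 0 ∧ T.diagram.cols = 0 := by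
    have := T.length_eq
    rw [FerrersDiagram.length] at this
    omega
  have hcell (T : TypeBTableau 0) (i j : ℕ) : (i, j) ∉ T.diagram.shape := fun h => by
    have := T.diagram.row_lt i j h
    have := hz T
    omega
  have hones (T : TypeBTableau 0) : T.ones = ∅ := by
    rw [Finset.eq_empty_iff_forall_notMem]
    rintro ⟨i, j⟩ h
    rcases T.ones_cell i j h with h | ⟨r, -, h⟩
    · have := hz T
      omega
    · exact hcell T _ _ h
  let T₀ : TypeBTableau 0 :=
    { diagram := ⟨0, 0, ⊥, fun i j h => absurd h (YoungDiagram.notMem_bot _),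
        fun i j h => absurd h (YoungDiagram.notMem_bot _)⟩
      length_eq := rfl
      ones := ∅
      ones_cell := fun i j h => absurd h (Finset.notMem_empty _)
      column_one := fun j hj => absurd hj (Nat.not_lt_zero j)
      zero_cond := fun i j _ _ h => by simp at h
      diag_cond := fun i j _ _ h => by simp at h }
  have huniq (T : TypeBTableau 0) : T = T₀ :=
    eq_of_diagram_ones (FerrersDiagram.eq_of_mem_iff (hz T).1 (hz T).2 fun i j =>
      iff_of_false (hcell T i j) (hcell T₀ i j)) (hones T)
  have hu : T₀.unrestricted = ∅ := by simp [unrestricted]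
  rw [tableauSum, Fintype.sum_eq_single T₀ fun T hT => absurd (huniq T) hT, hu]
  have h1 : T₀.row = 0 := rfl
  have h2 : T₀.diag = 0 := by simp [diag, hones]
  have h3 : T₀.so = 0 := by simp [so, hones]
  simp [h1, h2, h3]

theorem tableauSum_eq (n : ℕ) (φ : ℕ → R) :
    tableauSum p s q n φ = (tableauStep p s q)^[n] φ 0 := by
  induction n generalizing φ with
  | zero => exact tableauSum_zero p s q φ
  | succ n ih => rw [tableauSum_succ, ih, Function.iterate_succ_apply]

end Sum

end TypeBTableau

/-! ### The equidistribution theorem. -/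

theorem tableauPoly_eq_sum_signedPerm (n : ℕ) :
    tableauPoly n =
      ∑ π : SignedPerm n,
        PolyYTQ.y ^ SignedPerm.fwex π * Polynomial.C PolyYTQ.t ^ SignedPerm.neg π *
          Polynomial.C PolyYTQ.q ^ SignedPerm.cro π := by
  -- A row or weak excedance counts y²; a diagonal 1 or negative entry counts yt. The weight `1`
  -- forgets the unrestricted rows.
  have h := TypeBTableau.tableauSum_eq (PolyYTQ.y ^ 2) (PolyYTQ.y * Polynomial.C PolyYTQ.t)
    (Polynomial.C PolyYTQ.q) n (fun _ => 1)
  rw [tableauStep_iterate_one, ← SignedPerm.sum_weight] at h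
  calc tableauPoly n = _ := by
        rw [tableauPoly]
        refine Finset.sum_congr rfl fun T _ => ?_
        rw [pow_add, pow_mul]
        ring
    _ = _ := h
    _ = _ := by
        refine Finset.sum_congr rfl fun π _ => ?_
        rw [SignedPerm.weight, SignedPerm.fwex, pow_add, pow_mul]
        ring

theorem theorem1 (n : ℕ) :
    (tableauPoly n =
      ∑ π : SignedPerm n,
        PolyYTQ.y ^ SignedPerm.fwex π * Polynomial.C PolyYTQ.t ^ SignedPerm.neg π *
          Polynomial.C PolyYTQ.q ^ SignedPerm.cro π) ∧
    (∀ k : ℕ, (tableauPoly n).coeff k =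
      ∑ π : SignedPerm n with SignedPerm.fwex π = k,
        PolyYTQ.t ^ SignedPerm.neg π * PolyYTQ.q ^ SignedPerm.cro π) := by
  refine ⟨tableauPoly_eq_sum_signedPerm n, fun k => ?_⟩
  rw [tableauPoly_eq_sum_signedPerm, Polynomial.finsetSum_coeff, Finset.sum_filter]
  refine Finset.sum_congr rfl fun π _ => ?_
  rw [mul_assoc, ← Polynomial.C_pow, ← Polynomial.C_pow, ← Polynomial.C_mul,
    Polynomial.coeff_mul_C, PolyYTQ.y, Polynomial.coeff_X_pow, ite_mul, one_mul, zero_mul]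
  exact if_congr eq_comm rfl rfl
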